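/- Let $N\ge 1$ be an integer, let $k\ge 2$ be an even integer, let $\chi$ be a Dirichlet character modulo $N$, and let $f\in S_k(N,\chi)$ be a holomorphic cusp form with Fourier expansion $f(z)=\sum_{n\ge 1}c(n)e^{2\pi i n z}$. Let $d(n)$ denote the Fourier coefficients of $$(f|_kw_N)(z)=N^{k/2}(Nz)^{-k}f(-1/(Nz)).$$ For $s\in\mathbb C$ and $t>0$ put $$\psi_s(t)=\mathbf 1_{(0,1)}(t)\,\frac{(1-t)^{s-1}t^{k-s-1}}{\Gamma(s)},\qquad L_f(\psi_s)=\sum_{n\ge 1}c(n)\int_0^\infty\psi_s(t)e^{-2\pi n t}\,dt .$$ The series $L_f(\psi_s)$ converges absolutely (that is, the integrals converge absolutely and $\sum_{n\ge1}|c(n)|\int_0^\infty|\psi_s(t)|e^{-2\pi nt}\,dt<\infty$) for $0<\Re(s)<\frac{k-1}{2}$, and it has an analytic continuation to all $s\in\mathbb C$, whose value at $s=\frac{k-1}{2}$ is denoted by $L_f(\psi_{(k-1)/2})$. For every $\rho>1$, every $0<\varepsilon<1$ and all $X>0$, $$\sum_{1\le n<NX/(2\pi)}\frac{d(n)\,e^{-2\pi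 n/N}}{(2\pi n/N)^{\frac{k-1}{2}}}\left(1-\frac{2\pi n}{NX}\right)^{\rho}= i^{-k}N^{\frac k2}\,L_f\!\left(\psi_{\frac{k-1}{2}}\right)+O(X^{-\varepsilon}),$$ where the implied constant depends only on $f,\rho,\varepsilon$ and not on $X$. In particular, for $N=1$, $$\sum_{n<X/(2\pi)}\frac{d(n)e^{-2\pi n}}{(2\pi n)^{\frac{k-1}{2}}}\left(1-\frac{2\pi n}{X}\right)^{\rho}=i^{-k}L_f\!\left(\psi_{\frac{k-1}{2}}\right)+O(X^{-\varepsilon}).$$ -/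

import Mathlib

open scoped MatrixGroups ModularForm

noncomputable section

namespace RieszMean

/-- `f` belongs to `S_k(N, χ)`: a holomorphic cusp form of weight `k` on `Γ₁(N)` such that
`f ∣[k] γ = χ(d) f` for all `γ = (a, b; c, d)` in `Γ₀(N)`. -/
def HasNebentypus {N : ℕ} {k : ℤ} (χ : DirichletCharacter ℂ N)
    (f : CuspForm ((CongruenceSubgroup.Gamma1 N) : Subgroup (GL (Fin 2) ℝ)) k) : Prop :=
  ∀ γ : SL(2, ℤ), γ ∈ CongruenceSubgroup.Gamma0 N →
    (f : UpperHalfPlane → ℂ) ∣[k] γ = χ ((γ 1 1 : ℤ) : ZMod N) • (f : UpperHalfPlane → ℂ)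

theorem fricke_im_pos (N : ℕ) [NeZero N] (z : UpperHalfPlane) :
    0 < (-1 / ((N : ℂ) * (z : ℂ))).im := by
  have hN : (0 : ℝ) < N := Nat.cast_pos.mpr (NeZero.pos N)
  have hz : 0 < (z : ℂ).im := z.im_pos
  have hne : (N : ℂ) * (z : ℂ) ≠ 0 :=
    mul_ne_zero (Nat.cast_ne_zero.mpr (NeZero.ne N)) z.ne_zero
  have h1 : ((N : ℂ) * (z : ℂ)).im = N * (z : ℂ).im := by simp
  have h2 : (-1 / ((N : ℂ) * (z : ℂ))).im
      = ((N : ℂ) * (z : ℂ)).im / Complex.normSq ((N : ℂ) * (z : ℂ)) := by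
    rw [neg_div, one_div, Complex.neg_im, Complex.inv_im]
    ring
  rw [h2, h1]
  exact div_pos (mul_pos hN hz) (Complex.normSq_pos.mpr hne)

/-- The point `-1 / (N z)` of the upper half-plane. -/
def frickePoint (N : ℕ) [NeZero N] (z : UpperHalfPlane) : UpperHalfPlane :=
  ⟨-1 / ((N : ℂ) * (z : ℂ)), fricke_im_pos N z⟩

/-- `(f |_k w_N)(z) = N^{k/2} (N z)^{-k} f(-1 / (N z))`. -/
def fricke (N : ℕ) [NeZero N] (k : ℤ) (f : UpperHalfPlane → ℂ) (z : UpperHalfPlane) : ℂ :=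
  (((N : ℝ) ^ ((k : ℝ) / 2) : ℝ) : ℂ) * ((N : ℂ) * (z : ℂ)) ^ (-k) * f (frickePoint N z)

/-- The `n`-th Fourier coefficient of a `1`-periodic function: the coefficient of
`q^n = exp(2 π i n z)`. -/
def fourierCoefficient (f : UpperHalfPlane → ℂ) (n : ℕ) : ℂ :=
  (UpperHalfPlane.qExpansion 1 f).coeff n

/-- The Laplace transform `∫_0^∞ φ(x) e^{-s x} dx`. -/
def laplace (φ : ℝ → ℂ) (s : ℂ) : ℂ :=
  ∫ x in Set.Ioi (0 : ℝ), φ x * Complex.exp (-s * (x : ℂ))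

/-- Absolute convergence of the `L`-series at the test function `φ`, for a cusp form with Fourier
coefficients `c`: the Laplace integrals of `φ` converge absolutely for `Re s ≥ 0`, and
`∑ |c(n)| (𝓛|φ|)(2 π n)` converges. -/
def ConvergesAbsolutely (c : ℕ → ℂ) (φ : ℝ → ℂ) : Prop :=
  (∀ s : ℂ, 0 ≤ s.re →
    MeasureTheory.IntegrableOn (fun x : ℝ => φ x * Complex.exp (-s * (x : ℂ))) (Set.Ioi 0)) ∧
  Summable fun n : ℕ =>
    ‖c n‖ * ∫ x in Set.Ioi (0 : ℝ), ‖φ x‖ * Real.exp (-(2 * Real.pi * n) * x)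

/-- The `L`-series `L_f(φ) = ∑ c(n) (𝓛φ)(2 π n)` of a cusp form with Fourier coefficients `c`. -/
def LValue (c : ℕ → ℂ) (φ : ℝ → ℂ) : ℂ :=
  ∑' n : ℕ, c n * laplace φ ((2 * Real.pi * n : ℝ) : ℂ)

/-- The test function `ψ_s(t) = 1_{(0,1)}(t) (1 - t)^{s-1} t^{k-s-1} / Γ(s)`. -/
def psi (k : ℤ) (s : ℂ) : ℝ → ℂ :=
  Set.indicator (Set.Ioo 0 1) fun t : ℝ =>
    ((1 - t : ℝ) : ℂ) ^ (s - 1) * (t : ℂ) ^ ((k : ℂ) - s - 1) / Complex.Gamma s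

/-- `Λ` is the analytic continuation to all of `ℂ` of `s ↦ L_f(ψ_s)`, whose defining series
converges absolutely for `0 < Re s < (k - 1) / 2`. For `k ≥ 2` this strip is a non-empty open set,
so there is at most one such `Λ`. -/
def IsContinuationOfLPsi (k : ℤ) (f : UpperHalfPlane → ℂ) (Λ : ℂ → ℂ) : Prop :=
  Differentiable ℂ Λ ∧
  ∀ s : ℂ, 0 < s.re → s.re < ((k : ℝ) - 1) / 2 →
    ConvergesAbsolutely (fourierCoefficient f) (psi k s) ∧
    Λ s = LValue (fourierCoefficient f) (psi k s)

/-- With `ν_n = 2 π n / N`, the sum over the `n ≥ 1` with `ν_n < X` of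
`d(n) e^{-ν_n} ν_n^{-(k-1)/2} (1 - ν_n / X)^ρ`. -/
def rieszMean (N : ℕ) (k : ℤ) (d : ℕ → ℂ) (ρ X : ℝ) : ℂ :=
  ∑ n ∈ Finset.Ico 1 ⌈(N : ℝ) * X / (2 * Real.pi)⌉₊,
    d n * ((Real.exp (-(2 * Real.pi * n / N)) / (2 * Real.pi * n / N) ^ (((k : ℝ) - 1) / 2)
      * (1 - 2 * Real.pi * n / N / X) ^ ρ : ℝ) : ℂ)

end RieszMean

end

/-! Write `ν_n = 2πn/N` and `D(s) = ∑ d(n) e^{-ν_n} ν_n^{-s}`. The factor `e^{-ν_n}` makes `D`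
entire (`differentiable_dampedSeries`), and the heart of the proof is the identity `L_f(ψ_s) = i^k
N^{-k/2} D(s)` in the strip (`LValue_psi_eq_dampedSeries`). It comes from `L_f(ψ_s) = ∫ ψ_s(t) f(it)
dt`, the Fricke relation between `f(it)` and `(f|w_N)(i/(Nt))`, and `t = 1/(1+v)`: all powers of
`1+v` cancel, leaving the Mellin transform of `∑ d(n) e^{-ν_n} e^{-ν_n v}`. So `D` supplies the
continuation.

The Riesz mean is `D((k-1)/2)` with the weights `(1-ν_n/X)^ρ` inserted. They differ from `1` by at
most `(1+ρν_n) X^{-ε}`, and the damping absorbs the extra `ν_n`.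

Absolute convergence in the strip needs `∑ |c(n)| e^{-2πnt} ≪ t^{-(k+1)/2}` for `t ≤ 1`, which
follows from Parseval (`exists_tsum_sq_coeff_le`, `exists_tsum_coeff_le`). -/

namespace RieszMean

open UpperHalfPlane hiding I
open MeasureTheory Complex Filter Topology

/-! ### Mean bounds for the Fourier coefficients of a cusp form. -/

/-- The square-summability bound for Fourier coefficients of a cusp form. -/
theorem exists_tsum_sq_coeff_le {Γ : Subgroup (GL (Fin 2) ℝ)} [Γ.IsArithmetic] {k : ℤ}
    (f : CuspForm Γ k) (h1 : (1 : ℝ) ∈ Γ.strictPeriods) :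
    ∃ C : ℝ, 0 ≤ C ∧ ∀ y : ℝ, 0 < y →
      Summable (fun n : ℕ => (‖fourierCoefficient f n‖ * Real.exp (-(2 * Real.pi * n * y))) ^ 2) ∧
      ∑' n : ℕ, (‖fourierCoefficient f n‖ * Real.exp (-(2 * Real.pi * n * y))) ^ 2
        ≤ C * y ^ (-(k : ℝ)) := by
  obtain ⟨C, hC⟩ := CuspFormClass.exists_bound f
  refine ⟨C ^ 2, sq_nonneg _, fun y hy => ?_⟩
  have : Fact (IsCusp OnePoint.infty Γ) := ⟨Γ.isCusp_of_mem_strictPeriods one_pos h1⟩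
  -- On the horizontal line at height `y`, the `n`-th Fourier coefficient is `c(n) e^{-2πny}`;
  -- Parseval then turns the sup bound `|f| ≤ C y^{-k/2}` into the claim.
  set F : ℝ → ℂ := fun x => f ⟨x + y * I, by simpa using hy⟩ with hF
  have hFcont : Continuous F := by
    have hf : Continuous f := (ModularFormClass.holo f).continuous
    refine hf.comp ?_
    exact Continuous.upperHalfPlaneMk (by fun_prop) _
  have hL2 : MemLp F 2 (volume.restrict (Set.Ioc (0 : ℝ) 1)) := by
    obtain ⟨B, hB⟩ := isCompact_Icc.exists_bound_of_continuousOn (hFcont.continuousOn (s := Set.Icc 0 1))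
    refine MemLp.of_bound hFcont.aestronglyMeasurable B ?_
    filter_upwards [ae_restrict_mem measurableSet_Ioc] with x hx using hB x ⟨hx.1.le, hx.2⟩
  have hP := hasSum_sq_fourierCoeffOn (zero_lt_one' ℝ) hL2
  have hcoeff : ∀ n : ℕ, ‖fourierCoeffOn (zero_lt_one' ℝ) F n‖ =
      ‖fourierCoefficient f n‖ * Real.exp (-(2 * Real.pi * n * y)) := by
    intro n
    have hq := qExpansion_coeff_eq_intervalIntegral (h := 1) one_pos
      (SlashInvariantFormClass.periodic_comp_ofComplex f h1) (ModularFormClass.holo f)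
      (ModularFormClass.bdd_at_infty f) n hy
    have : fourierCoeffOn (zero_lt_one' ℝ) F n
        = fourierCoefficient f n * cexp (-(2 * Real.pi * n * y)) := by
      rw [fourierCoefficient, hq, fourierCoeffOn_eq_integral]
      simp only [ofReal_one, sub_zero, one_div, inv_one, one_smul, one_mul]
      rw [← intervalIntegral.integral_mul_const]
      refine intervalIntegral.integral_congr fun x _ => ?_
      simp only [hF, fourier_coe_apply, smul_eq_mul, UpperHalfPlane.coe_I]
      rw [Function.Periodic.qParam, ← Complex.exp_nat_mul, ← Complex.exp_neg,
        mul_right_comm (cexp _) (f _), ← Complex.exp_add]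
      congr 2
      push_cast
      linear_combination (2 * Real.pi * n * y : ℂ) * I_sq
    rw [this, norm_mul, Complex.norm_exp]
    congr 2
    simp
  have hinj : Function.Injective (fun n : ℕ => (n : ℤ)) := Nat.cast_injective
  have hs := hP.summable.comp_injective hinj
  have e : (fun n : ℕ => (‖fourierCoefficient f n‖ * Real.exp (-(2 * Real.pi * n * y))) ^ 2)
      = (fun i : ℤ => ‖fourierCoeffOn (zero_lt_one' ℝ) F i‖ ^ 2) ∘ (fun n : ℕ => (n : ℤ)) := by
    funext n; simp [hcoeff]
  rw [e]
  refine ⟨hs, ?_⟩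
  calc _ ≤ ∑' i : ℤ, ‖fourierCoeffOn (zero_lt_one' ℝ) F i‖ ^ 2 :=
        tsum_comp_le_tsum_of_inj hP.summable (fun _ => by positivity) hinj
    _ = ∫ x in (0 : ℝ)..1, ‖F x‖ ^ 2 := by rw [hP.tsum_eq]; simp
    _ ≤ ∫ x in (0 : ℝ)..1, C ^ 2 * y ^ (-(k : ℝ)) := by
        refine intervalIntegral.integral_mono_on zero_le_one
          ((hFcont.norm.pow 2).intervalIntegrable _ _) (by simp) fun x _ => ?_
        have := hC ⟨x + y * I, by simpa using hy⟩
        have him : UpperHalfPlane.im ⟨x + y * I, by simpa using hy⟩ = y := by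
          change (x + y * I : ℂ).im = y
          simp
        rw [him] at this
        calc ‖F x‖ ^ 2 ≤ (C / y ^ (k / 2 : ℝ)) ^ 2 := by
              gcongr
          _ = C ^ 2 * y ^ (-(k : ℝ)) := by
              rw [div_pow, ← Real.rpow_natCast (y ^ _), ← Real.rpow_mul hy.le, Real.rpow_neg hy.le,
                div_eq_mul_inv]
              congr 3; push_cast; ring
    _ = C ^ 2 * y ^ (-(k : ℝ)) := by simp

theorem tsum_exp_neg_le {t : ℝ} (ht : 0 < t) (ht1 : t ≤ 1) :
    Summable (fun n : ℕ => Real.exp (-(2 * Real.pi * n * t))) ∧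
      ∑' n : ℕ, Real.exp (-(2 * Real.pi * n * t)) ≤ 2 / t := by
  have hx : 1 ≤ 2 * Real.pi := by linarith [Real.pi_gt_three]
  have e : (fun n : ℕ => Real.exp (-(2 * Real.pi * n * t)))
      = fun n : ℕ => Real.exp (-(2 * Real.pi * t)) ^ n := by
    funext n; rw [← Real.exp_nat_mul]; congr 1; ring
  have hlt : Real.exp (-(2 * Real.pi * t)) < 1 := by
    rw [Real.exp_lt_one_iff]; nlinarith
  rw [e, tsum_geometric_of_lt_one (Real.exp_pos _).le hlt]
  refine ⟨summable_geometric_of_lt_one (Real.exp_pos _).le hlt, ?_⟩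
  -- This gives `1 - e^{-2πt} ≥ t/(1+t) ≥ t/2`, the last step using `t ≤ 1`.
  have h1 : Real.exp (-(2 * Real.pi * t)) * (1 + t) ≤ 1 := by
    rw [Real.exp_neg, inv_mul_le_iff₀ (Real.exp_pos _)]
    have := Real.add_one_le_exp (2 * Real.pi * t)
    nlinarith
  rw [inv_le_comm₀ (by linarith) (by positivity), inv_div]
  nlinarith [Real.exp_pos (-(2 * Real.pi * t))]

/-- A mean-square bound for the coefficients yields a bound for their absolute sums, by the
inequality between the geometric and the arithmetic mean. -/
theorem exists_tsum_coeff_le {c : ℕ → ℂ} {k C : ℝ} (hC : 0 ≤ C)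
    (h : ∀ y : ℝ, 0 < y →
      Summable (fun n : ℕ => (‖c n‖ * Real.exp (-(2 * Real.pi * n * y))) ^ 2) ∧
      ∑' n : ℕ, (‖c n‖ * Real.exp (-(2 * Real.pi * n * y))) ^ 2 ≤ C * y ^ (-k)) :
    ∃ D : ℝ, 0 ≤ D ∧ ∀ t : ℝ, 0 < t → t ≤ 1 →
      Summable (fun n : ℕ => ‖c n‖ * Real.exp (-(2 * Real.pi * n) * t)) ∧
      ∑' n : ℕ, ‖c n‖ * Real.exp (-(2 * Real.pi * n) * t) ≤ D * t ^ (-((k + 1) / 2)) := by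
  refine ⟨C * 2 ^ k + 2, by positivity, fun t ht ht1 => ?_⟩
  obtain ⟨hs, hle⟩ := h (t / 2) (by positivity)
  obtain ⟨hs', hle'⟩ := tsum_exp_neg_le ht ht1
  -- This weight balances the two halves: `l t^{-k}` and `l⁻¹ t^{-1}` both equal `t^{-(k+1)/2}`.
  set l : ℝ := t ^ ((k - 1) / 2) with hl
  have hl0 : 0 < l := Real.rpow_pos_of_pos ht _
  have hterm : ∀ n : ℕ, ‖c n‖ * Real.exp (-(2 * Real.pi * n) * t) ≤
      l * (‖c n‖ * Real.exp (-(2 * Real.pi * n * (t / 2)))) ^ 2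
        + l⁻¹ * Real.exp (-(2 * Real.pi * n * t)) := by
    intro n
    have e1 : Real.exp (-(2 * Real.pi * n) * t) = Real.exp (-(2 * Real.pi * n * (t / 2))) ^ 2 := by
      rw [← Real.exp_nat_mul]; congr 1; push_cast; ring
    have e2 : Real.exp (-(2 * Real.pi * n * t)) = Real.exp (-(2 * Real.pi * n * (t / 2))) ^ 2 := by
      rw [← Real.exp_nat_mul]; congr 1; push_cast; ring
    rw [e1, e2]
    set E := Real.exp (-(2 * Real.pi * n * (t / 2)))
    have key : 0 ≤ l⁻¹ * (l * ‖c n‖ - 1 / 2) ^ 2 * E ^ 2 := by positivity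
    have : l⁻¹ * (l * ‖c n‖ - 1 / 2) ^ 2 * E ^ 2
        = l * (‖c n‖ * E) ^ 2 + l⁻¹ * E ^ 2 - ‖c n‖ * E ^ 2 - 3 / 4 * (l⁻¹ * E ^ 2) := by
      field_simp; ring
    have : 0 ≤ l⁻¹ * E ^ 2 := by positivity
    linarith
  have hsum := (hs.mul_left l).add (hs'.mul_left l⁻¹)
  have hS := Summable.of_nonneg_of_le (fun n => by positivity) hterm hsum
  refine ⟨hS, (hS.tsum_le_tsum hterm hsum).trans ?_⟩
  rw [(hs.mul_left l).tsum_add (hs'.mul_left l⁻¹), tsum_mul_left, tsum_mul_left]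
  calc _ ≤ l * (C * (t / 2) ^ (-k)) + l⁻¹ * (2 / t) := by gcongr
    _ = C * 2 ^ k * (t ^ ((k - 1) / 2) * t ^ (-k))
          + 2 * (t ^ (-((k - 1) / 2)) * t ^ (-1 : ℝ)) := by
        rw [Real.div_rpow ht.le (by norm_num), Real.rpow_neg (by norm_num : (0 : ℝ) ≤ 2),
          Real.rpow_neg ht.le ((k - 1) / 2), Real.rpow_neg_one, hl]
        field_simp
    _ = _ := by
        rw [← Real.rpow_add ht, ← Real.rpow_add ht, add_mul]
        congr 3 <;> ring

/-! ### The test functions `ψ_s` and absolute convergence. -/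

theorem integrableOn_rpow_mul_one_sub_rpow {u v : ℝ} (hu : 0 < u) (hv : 0 < v) :
    IntegrableOn (fun t : ℝ => (1 - t) ^ (v - 1) * t ^ (u - 1)) (Set.Ioo 0 1) := by
  have h := Complex.betaIntegral_convergent (u := (u : ℂ)) (v := (v : ℂ)) (by simpa) (by simpa)
  rw [intervalIntegrable_iff_integrableOn_Ioo_of_le zero_le_one] at h
  refine IntegrableOn.congr_fun h.norm (fun t ht => ?_) measurableSet_Ioo
  have h1 : (0 : ℝ) < 1 - t := by linarith [ht.2]
  have := norm_cpow_eq_rpow_re_of_pos h1 ((v : ℂ) - 1)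
  push_cast at this
  simp only [norm_mul]
  rw [this, norm_cpow_eq_rpow_re_of_pos ht.1, mul_comm]
  simp

theorem measurable_psi (k : ℤ) (s : ℂ) : Measurable (psi k s) := by
  unfold psi
  refine Measurable.indicator ?_ measurableSet_Ioo
  fun_prop

theorem norm_psi (k : ℤ) (s : ℂ) (t : ℝ) :
    ‖psi k s t‖ = Set.indicator (Set.Ioo 0 1) (fun t : ℝ =>
      (1 - t) ^ (s.re - 1) * t ^ ((k - s.re) - 1)) t / ‖Gamma s‖ := by
  by_cases ht : t ∈ Set.Ioo (0 : ℝ) 1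
  · have h1 : (0 : ℝ) < 1 - t := by linarith [ht.2]
    simp only [psi, Set.indicator_of_mem ht, norm_div, norm_mul]
    rw [norm_cpow_eq_rpow_re_of_pos h1, norm_cpow_eq_rpow_re_of_pos ht.1]
    simp
  · simp [psi, Set.indicator_of_notMem ht]

/-- A Beta integral. It is used with `r = 0` for the individual Laplace integrals and with `r =
-(k+1)/2` for the whole series. -/
theorem integrableOn_norm_psi_mul_rpow (k : ℤ) {s : ℂ} {r : ℝ} (hs : 0 < s.re)
    (hr : s.re < k + r) : IntegrableOn (fun t => ‖psi k s t‖ * t ^ r) (Set.Ioi 0) := by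
  have h := (integrableOn_rpow_mul_one_sub_rpow (u := k - s.re + r) (by linarith) hs).div_const
    ‖Gamma s‖
  refine (((integrable_indicator_iff measurableSet_Ioo).2 h).restrict (s := Set.Ioi 0)).congr ?_
  filter_upwards with t
  rw [norm_psi]
  by_cases ht : t ∈ Set.Ioo (0 : ℝ) 1
  · simp only [Set.indicator_of_mem ht]
    rw [show (k : ℝ) - s.re + r - 1 = (k - s.re - 1) + r by ring, Real.rpow_add ht.1]
    ring
  · simp [Set.indicator_of_notMem ht]

theorem convergesAbsolutely_psi {c : ℕ → ℂ} {k : ℤ} {D : ℝ}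
    (hD : ∀ t : ℝ, 0 < t → t ≤ 1 →
      Summable (fun n : ℕ => ‖c n‖ * Real.exp (-(2 * Real.pi * n) * t)) ∧
      ∑' n : ℕ, ‖c n‖ * Real.exp (-(2 * Real.pi * n) * t) ≤ D * t ^ (-(((k : ℝ) + 1) / 2)))
    {s : ℂ} (hs : 0 < s.re) (hs1 : s.re < ((k : ℝ) - 1) / 2) :
    ConvergesAbsolutely c (psi k s) := by
  have hk : s.re < k + (0 : ℝ) := by linarith
  have hint : ∀ z : ℂ, 0 ≤ z.re →
      IntegrableOn (fun x : ℝ => psi k s x * cexp (-z * (x : ℂ))) (Set.Ioi 0) := by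
    intro z hz
    refine (integrableOn_norm_psi_mul_rpow k hs hk).mono'
      ((measurable_psi k s).mul (by fun_prop)).aestronglyMeasurable ?_
    filter_upwards [ae_restrict_mem measurableSet_Ioi] with t ht
    rw [norm_mul, Complex.norm_exp, Real.rpow_zero]
    refine mul_le_mul_of_nonneg_left ?_ (norm_nonneg _)
    rw [Real.exp_le_one_iff]
    have : 0 ≤ z.re * t := mul_nonneg hz (le_of_lt ht)
    simpa using this
  have hint' : ∀ n : ℕ, IntegrableOn
      (fun x : ℝ => ‖c n‖ * (‖psi k s x‖ * Real.exp (-(2 * Real.pi * n) * x))) (Set.Ioi 0) := by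
    intro n
    refine Integrable.const_mul ?_ _
    refine (hint ((2 * Real.pi * n : ℝ) : ℂ) (by rw [ofReal_re]; positivity)).norm.congr ?_
    filter_upwards with x
    rw [norm_mul, Complex.norm_exp]
    simp
  refine ⟨hint, ?_⟩
  -- Integrability at `0` here is exactly `Re s < (k-1)/2`. All partial sums are bounded by this one
  -- integral, since `ψ_s` vanishes for `t ≥ 1`.
  have hdom := (integrableOn_norm_psi_mul_rpow k (r := -(((k : ℝ) + 1) / 2)) hs
    (by linarith)).const_mul D
  refine summable_of_sum_le (c := ∫ t in Set.Ioi (0 : ℝ),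
    D * (‖psi k s t‖ * t ^ (-(((k : ℝ) + 1) / 2)))) (fun n => ?_) fun u => ?_
  · exact mul_nonneg (norm_nonneg _) (integral_nonneg fun _ => by positivity)
  · simp_rw [← integral_const_mul]
    rw [← integral_finsetSum _ fun n _ => hint' n]
    refine setIntegral_mono_on (integrable_finsetSum _ fun n _ => hint' n) hdom
      measurableSet_Ioi fun t ht => ?_
    by_cases ht1 : t < 1
    · obtain ⟨h1, h2⟩ := hD t ht ht1.le
      calc _ = ‖psi k s t‖ * ∑ n ∈ u, ‖c n‖ * Real.exp (-(2 * Real.pi * n) * t) := by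
            rw [Finset.mul_sum]; exact Finset.sum_congr rfl fun _ _ => by ring
        _ ≤ ‖psi k s t‖ * (D * t ^ (-(((k : ℝ) + 1) / 2))) := by
            gcongr
            exact (h1.sum_le_tsum u fun _ _ => by positivity).trans h2
        _ = _ := by ring
    · have : psi k s t = 0 := Set.indicator_of_notMem (fun h => ht1 h.2) _
      simp [this]

theorem LValue_eq_integral {c : ℕ → ℂ} {φ : ℝ → ℂ} (h : ConvergesAbsolutely c φ) {F : ℝ → ℂ}
    (hF : ∀ t : ℝ, 0 < t → HasSum (fun n : ℕ => c n * cexp (-((2 * Real.pi * n : ℝ) : ℂ) * t)) (F t)) :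
    LValue c φ = ∫ t in Set.Ioi (0 : ℝ), φ t * F t := by
  have hint : ∀ n : ℕ, IntegrableOn
      (fun x : ℝ => c n * (φ x * cexp (-((2 * Real.pi * n : ℝ) : ℂ) * x))) (Set.Ioi 0) :=
    fun n => (h.1 _ (by rw [ofReal_re]; positivity)).const_mul _
  have hs : Summable fun n : ℕ => ∫ x in Set.Ioi (0 : ℝ),
      ‖c n * (φ x * cexp (-((2 * Real.pi * n : ℝ) : ℂ) * x))‖ := by
    refine h.2.congr fun n => ?_
    rw [← integral_const_mul]
    refine integral_congr_ae (Eventually.of_forall fun x => ?_)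
    simp [Complex.norm_exp]
  rw [LValue]
  simp_rw [laplace, ← integral_const_mul]
  rw [integral_tsum_of_summable_integral_norm hint hs]
  refine setIntegral_congr_fun measurableSet_Ioi fun t ht => ?_
  rw [← (hF t ht).tsum_eq, ← tsum_mul_left]
  exact tsum_congr fun n => by ring

/-! ### The Fricke involution. -/

/-- The matrix `(0, -1; N, 0)` of the Fricke involution. -/
noncomputable def frickeMatrix (N : ℕ) [NeZero N] : GL (Fin 2) ℝ :=
  Matrix.GeneralLinearGroup.mkOfDetNeZero !![0, -1; (N : ℝ), 0]
    (by simp [Matrix.det_fin_two, NeZero.ne N])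

theorem det_frickeMatrix (N : ℕ) [NeZero N] : (frickeMatrix N).det.val = N := by
  simp [frickeMatrix, Matrix.GeneralLinearGroup.mkOfDetNeZero, Matrix.det_fin_two]

theorem frickeMatrix_smul (N : ℕ) [NeZero N] (z : ℍ) :
    frickeMatrix N • z = frickePoint N z := by
  have hN : (0 : ℝ) < N := Nat.cast_pos.mpr (NeZero.pos N)
  ext
  rw [UpperHalfPlane.coe_smul_of_det_pos (by rw [det_frickeMatrix]; exact hN)]
  simp [num, denom, frickeMatrix, frickePoint, Matrix.GeneralLinearGroup.mkOfDetNeZero]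

theorem fricke_eq_smul_slash (N : ℕ) [NeZero N] (k : ℤ) (f : ℍ → ℂ) :
    fricke N k f = ((((N : ℝ) ^ ((k : ℝ) / 2) : ℝ) : ℂ) * ((N : ℂ) ^ (k - 1))⁻¹) •
      (f ∣[k] frickeMatrix N) := by
  have hN : (0 : ℝ) < N := Nat.cast_pos.mpr (NeZero.pos N)
  have hN' : (N : ℂ) ^ (k - 1) ≠ 0 := zpow_ne_zero _ (by simp [NeZero.ne N])
  funext z
  rw [Pi.smul_apply, ModularForm.slash_apply, det_frickeMatrix, frickeMatrix_smul, σ,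
    if_pos (by rw [det_frickeMatrix]; exact hN), fricke]
  have : denom (frickeMatrix N) z = N * z := by
    simp [denom, frickeMatrix, Matrix.GeneralLinearGroup.mkOfDetNeZero]
  rw [this]
  simp only [abs_of_pos hN, smul_eq_mul]
  simp
  field_simp

open ConjAct Pointwise in
-- Conjugating `(1, 1; 0, 1)` by the Fricke matrix gives `(1, 0; -N, 1)`, which lies in `Γ₁(N)`.
-- Hence `f|w_N`, taken as a form on the conjugate group, has a `q`-expansion of width `1`, with no
-- need to identify that group with `Γ₁(N)`.
theorem one_mem_strictPeriods_conj_frickeMatrix (N : ℕ) [NeZero N] :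
    (1 : ℝ) ∈ (toConjAct (frickeMatrix N)⁻¹ •
      (CongruenceSubgroup.Gamma1 N : Subgroup (GL (Fin 2) ℝ))).strictPeriods := by
  rw [Subgroup.mem_strictPeriods_iff, Subgroup.mem_pointwise_smul_iff_inv_smul_mem]
  obtain ⟨γ, hγ⟩ : ∃ γ : SL(2, ℤ), γ.1 = !![1, 0; -(N : ℤ), 1] :=
    ⟨⟨_, by simp [Matrix.det_fin_two]⟩, rfl⟩
  refine ⟨γ, (CongruenceSubgroup.Gamma1_mem N γ).2 (by simp [hγ]), ?_⟩
  rw [← toConjAct_inv, inv_inv, toConjAct_smul, eq_mul_inv_iff_mul_eq]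
  ext i j
  fin_cases i <;> fin_cases j <;>
    simp [hγ, frickeMatrix, Matrix.GeneralLinearGroup.mkOfDetNeZero, Matrix.mul_apply,
      Fin.sum_univ_two, Matrix.GeneralLinearGroup.upperRightHom]

open ConjAct Pointwise in
theorem exists_cuspForm_eq_fricke {N : ℕ} [NeZero N] {k : ℤ}
    (f : CuspForm (CongruenceSubgroup.Gamma1 N : Subgroup (GL (Fin 2) ℝ)) k) :
    ∃ g : CuspForm (toConjAct (frickeMatrix N)⁻¹ •
      (CongruenceSubgroup.Gamma1 N : Subgroup (GL (Fin 2) ℝ))) k, ⇑g = fricke N k f :=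
  ⟨((((N : ℝ) ^ ((k : ℝ) / 2) : ℝ) : ℂ) * ((N : ℂ) ^ (k - 1))⁻¹) •
    CuspForm.translate f (frickeMatrix N), (fricke_eq_smul_slash N k f).symm⟩

theorem hasSum_fourierCoefficient {Γ : Subgroup (GL (Fin 2) ℝ)} {k : ℤ} (f : CuspForm Γ k)
    (h1 : (1 : ℝ) ∈ Γ.strictPeriods) {t : ℝ} (ht : 0 < t) :
    HasSum (fun n : ℕ => fourierCoefficient f n * cexp (-((2 * Real.pi * n : ℝ) : ℂ) * t))
      (f ⟨I * t, by simpa using ht⟩) := by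
  have : Fact (IsCusp OnePoint.infty Γ) := ⟨Γ.isCusp_of_mem_strictPeriods one_pos h1⟩
  convert ModularForm.hasSum_qExpansion f one_pos h1 ⟨I * t, by simpa using ht⟩ using 2 with n
  rw [fourierCoefficient, Function.Periodic.qParam, ← Complex.exp_nat_mul]
  congr 2
  push_cast
  linear_combination (-2 * Real.pi * n * t : ℂ) * I_sq

theorem fourierCoefficient_zero {Γ : Subgroup (GL (Fin 2) ℝ)} {k : ℤ} (f : CuspForm Γ k)
    (h1 : (1 : ℝ) ∈ Γ.strictPeriods) : fourierCoefficient f 0 = 0 :=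
  CuspFormClass.qExpansion_coeff_zero f one_pos h1

theorem fricke_apply_imaginary_axis (N : ℕ) [NeZero N] (k : ℤ) (f : ℍ → ℂ) {t : ℝ} (ht : 0 < t) :
    f ⟨I * t, by simpa using ht⟩ = I ^ k * ((((N : ℝ) ^ ((k : ℝ) / 2) : ℝ) : ℂ))⁻¹ * (t : ℂ) ^ (-k) *
      fricke N k f ⟨I * ((N * t)⁻¹ : ℝ), by
        have : (0 : ℝ) < N := Nat.cast_pos.mpr (NeZero.pos N)
        simp; positivity⟩ := by
  have hN : (0 : ℝ) < N := Nat.cast_pos.mpr (NeZero.pos N)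
  have hN' : (N : ℂ) ≠ 0 := by simp [NeZero.ne N]
  have ht' : (t : ℂ) ≠ 0 := by simpa using ht.ne'
  have hA : ((((N : ℝ) ^ ((k : ℝ) / 2) : ℝ) : ℂ)) ≠ 0 := by
    simpa using (Real.rpow_pos_of_pos hN _).ne'
  have hp : frickePoint N ⟨I * ((N * t)⁻¹ : ℝ), by simp; positivity⟩
      = ⟨I * t, by simpa using ht⟩ := by
    ext
    simp only [frickePoint]
    push_cast
    field_simp
    simp
  rw [fricke, hp]
  have : (N : ℂ) * (I * ((N * t)⁻¹ : ℝ)) = I * (t : ℂ)⁻¹ := by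
    push_cast; field_simp
  simp only [this]
  rw [mul_zpow, inv_zpow, zpow_neg, zpow_neg]
  have := zpow_ne_zero k I_ne_zero
  have := zpow_ne_zero k ht'
  field_simp

/-! ### The substitution `t = 1/(1+v)`. -/

theorem image_inv_one_add : (fun v : ℝ => (1 + v)⁻¹) '' Set.Ioi 0 = Set.Ioo 0 1 := by
  ext t
  constructor
  · rintro ⟨v, hv, rfl⟩
    have hv : 0 < v := hv
    exact ⟨by positivity, inv_lt_one_of_one_lt₀ (by linarith)⟩
  · rintro ⟨h0, h1⟩
    exact ⟨t⁻¹ - 1, by simpa using one_lt_inv_iff₀.2 ⟨h0, h1⟩, by simp⟩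

/-- Since `1-t = v/(1+v)`, the exponents of `1/(1+v)` add up to `k-2`, free of `s`. The Jacobian
`(1+v)^{-2}` and the automorphy factor `(1+v)^k` later cancel this power. -/
theorem psi_inv_one_add (k : ℤ) (s : ℂ) {v : ℝ} (hv : 0 < v) :
    psi k s (1 + v)⁻¹ = (v : ℂ) ^ (s - 1) * ((1 + v : ℝ) : ℂ) ^ (2 - k) / Gamma s := by
  have h1 : (1 + v)⁻¹ ∈ Set.Ioo (0 : ℝ) 1 := image_inv_one_add ▸ Set.mem_image_of_mem _ hv
  have h2 : 1 - (1 + v)⁻¹ = v * (1 + v)⁻¹ := by field_simp; ring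
  have hne : (((1 + v)⁻¹ : ℝ) : ℂ) ≠ 0 := by exact_mod_cast h1.1.ne'
  rw [psi, Set.indicator_of_mem h1, h2, ofReal_mul, mul_cpow_ofReal_nonneg hv.le h1.1.le,
    mul_assoc, ← cpow_add _ _ hne]
  have : (s - 1 + (k - s - 1) : ℂ) = ((k - 2 : ℤ) : ℂ) := by push_cast; ring
  rw [this, cpow_intCast, ofReal_inv, inv_zpow, ← zpow_neg, neg_sub]

/-- The substitution `t = 1 / (1 + v)` turns an integral against `ψ_s` into a Mellin transform. -/
theorem integral_psi_mul {k : ℤ} {s A : ℂ} {F G : ℝ → ℂ}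
    (hFG : ∀ v : ℝ, 0 < v → F (1 + v)⁻¹ = A * ((1 + v : ℝ) : ℂ) ^ k * G v) :
    ∫ t in Set.Ioi (0 : ℝ), psi k s t * F t = A / Gamma s * mellin G s := by
  have hsub : ∫ t in Set.Ioi (0 : ℝ), psi k s t * F t = ∫ t in Set.Ioo (0 : ℝ) 1, psi k s t * F t := by
    refine (setIntegral_eq_of_subset_of_forall_sdiff_eq_zero measurableSet_Ioi
      Set.Ioo_subset_Ioi_self fun t ht => ?_)
    rw [psi, Set.indicator_of_notMem ht.2, zero_mul]
  have hderiv : ∀ v ∈ Set.Ioi (0 : ℝ),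
      HasDerivWithinAt (fun v : ℝ => (1 + v)⁻¹) (-1 / (1 + v) ^ 2) (Set.Ioi 0) v := by
    intro v hv
    have hv : 0 < v := hv
    exact (((hasDerivAt_id v).const_add 1).inv (by simp; positivity)).hasDerivWithinAt
  have hinj : Set.InjOn (fun v : ℝ => (1 + v)⁻¹) (Set.Ioi 0) := by
    intro a _ b _ h
    simpa using h
  rw [hsub, ← image_inv_one_add, integral_image_eq_integral_abs_deriv_smul measurableSet_Ioi hderiv
    hinj, mellin, ← integral_const_mul]
  refine setIntegral_congr_fun measurableSet_Ioi fun v hv => ?_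
  have hv : 0 < v := hv
  have hne : ((1 + v : ℝ) : ℂ) ≠ 0 := by exact_mod_cast (by positivity : (1 + v : ℝ) ≠ 0)
  simp only [hFG v hv, psi_inv_one_add k s hv, smul_eq_mul, real_smul]
  rw [neg_div, abs_neg, abs_of_pos (by positivity), zpow_sub₀ hne]
  have := zpow_ne_zero k hne
  push_cast at *
  field_simp

/-! ### The damped Dirichlet series. -/

/-- The Dirichlet series `∑ d(n) e^{-ν_n} ν_n^{-s}` with `ν_n = 2 π n / N`. -/
noncomputable def dampedSeries (N : ℕ) (d : ℕ → ℂ) (s : ℂ) : ℂ :=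
  ∑' n : ℕ, d n * (Real.exp (-(2 * Real.pi * n / N)) : ℂ) * ((2 * Real.pi * n / N : ℝ) : ℂ) ^ (-s)

theorem frequency_pos (N : ℕ) [NeZero N] {n : ℕ} (hn : n ≠ 0) : 0 < 2 * Real.pi * n / N := by
  have hN : (0 : ℝ) < N := Nat.cast_pos.mpr (NeZero.pos N)
  have hn : (0 : ℝ) < n := Nat.cast_pos.mpr (Nat.pos_of_ne_zero hn)
  positivity

/-- Half of the exponential damping absorbs any power of `ν_n`. -/
theorem summable_damped_mul_rpow {N : ℕ} [NeZero N] {d : ℕ → ℂ}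
    (hd : Summable fun n : ℕ => ‖d n‖ * Real.exp (-(2 * Real.pi * n / N) / 2)) (r : ℝ) :
    Summable fun n : ℕ => ‖d n‖ * Real.exp (-(2 * Real.pi * n / N)) * (2 * Real.pi * n / N) ^ r := by
  have hN : (0 : ℝ) < N := Nat.cast_pos.mpr (NeZero.pos N)
  have hν : Tendsto (fun n : ℕ => 2 * Real.pi * n / N) atTop atTop := by
    have : (fun n : ℕ => 2 * Real.pi * n / N) = fun n : ℕ => (2 * Real.pi / N) * (n : ℝ) := by
      funext n; ring
    rw [this]
    exact tendsto_natCast_atTop_atTop.const_mul_atTop (by positivity)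
  have ht := (tendsto_rpow_mul_exp_neg_mul_atTop_nhds_zero r (1 / 2) (by norm_num)).comp hν
  refine hd.of_norm_bounded_eventually_nat ?_
  filter_upwards [ht.eventually_le_const zero_lt_one] with n hn
  rw [Real.norm_of_nonneg (by positivity)]
  set x := 2 * Real.pi * n / N
  have : Real.exp (-x) = Real.exp (-x / 2) * Real.exp (-(1 / 2) * x) := by
    rw [← Real.exp_add]; congr 1; ring
  calc _ = ‖d n‖ * Real.exp (-x / 2) * (x ^ r * Real.exp (-(1 / 2) * x)) := by rw [this]; ring
    _ ≤ ‖d n‖ * Real.exp (-x / 2) * 1 := by gcongr; exact hn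
    _ = _ := mul_one _

/-- On the disc of radius `R`, `ν^{-Re s} ≤ ν^R + ν^{-R}` gives a summable majorant independent of
`s`. -/
theorem differentiable_dampedSeries {N : ℕ} [NeZero N] {d : ℕ → ℂ} (d0 : d 0 = 0)
    (hd : ∀ r : ℝ, Summable fun n : ℕ =>
      ‖d n‖ * Real.exp (-(2 * Real.pi * n / N)) * (2 * Real.pi * n / N) ^ r) :
    Differentiable ℂ (dampedSeries N d) := by
  intro s₀
  set R : ℝ := ‖s₀‖ + 1
  have hR : s₀ ∈ Metric.ball (0 : ℂ) R := by simp [R]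
  refine (differentiableOn_tsum_of_summable_norm ((hd R).add (hd (-R))) (fun n => ?_)
    Metric.isOpen_ball fun n s hs => ?_).differentiableAt (Metric.isOpen_ball.mem_nhds hR)
  -- The power `0 ^ (-s)` jumps to `1` at `s = 0`; `d 0 = 0` removes this term.
  · rcases eq_or_ne n 0 with rfl | hn
    · simp [d0]
    · have hν := frequency_pos N hn
      refine DifferentiableOn.const_mul ?_ _
      exact (differentiable_neg.const_cpow (Or.inl (by exact_mod_cast hν.ne'))).differentiableOn
  · rcases eq_or_ne n 0 with rfl | hn
    · simp [d0]
    · have hν := frequency_pos N hn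
      have hs' : |s.re| ≤ R := (abs_re_le_norm s).trans (by simpa using (mem_ball_zero_iff.1 hs).le)
      obtain ⟨h1, h2⟩ := abs_le.1 hs'
      rw [norm_mul, norm_mul, norm_cpow_eq_rpow_re_of_pos hν, neg_re, norm_real,
        Real.norm_of_nonneg (Real.exp_pos _).le, ← mul_add]
      refine mul_le_mul_of_nonneg_left ?_ (by positivity)
      have := Real.rpow_pos_of_pos hν R
      have := Real.rpow_pos_of_pos hν (-R)
      rcases le_total 1 (2 * Real.pi * n / N) with h | h
      · have := Real.rpow_le_rpow_of_exponent_le h (by linarith : -s.re ≤ R)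
        linarith
      · have := Real.rpow_le_rpow_of_exponent_ge hν h (by linarith : -R ≤ -s.re)
        linarith

/-- Termwise, `e^{-ν(1+v)} = e^{-ν} e^{-νv}`, and the Mellin transform of `e^{-νv}` is `Γ(s)
ν^{-s}`: the damping is the trace of the `1` in `1+v`. -/
theorem mellin_eq_dampedSeries {N : ℕ} [NeZero N] {d : ℕ → ℂ} (d0 : d 0 = 0)
    (hd : ∀ r : ℝ, Summable fun n : ℕ =>
      ‖d n‖ * Real.exp (-(2 * Real.pi * n / N)) * (2 * Real.pi * n / N) ^ r)
    {G : ℝ → ℂ} (hG : ∀ v : ℝ, 0 < v → HasSum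
      (fun n : ℕ => d n * cexp (-((2 * Real.pi * n : ℝ) : ℂ) * (((1 + v) / N : ℝ) : ℂ))) (G v))
    {s : ℂ} (hs : 0 < s.re) : mellin G s = Gamma s * dampedSeries N d s := by
  have h := hasSum_mellin (a := fun n : ℕ => d n * (Real.exp (-(2 * Real.pi * n / N)) : ℂ))
    (p := fun n : ℕ => 2 * Real.pi * n / N) (F := G) (s := s) (fun n => ?_) hs (fun v hv => ?_) ?_
  · rw [← h.tsum_eq, dampedSeries, ← tsum_mul_left]
    refine tsum_congr fun n => ?_
    rw [cpow_neg]
    ring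
  · rcases eq_or_ne n 0 with rfl | hn
    · simp [d0]
    · exact Or.inr (frequency_pos N hn)
  · convert hG v hv using 2 with n
    push_cast
    rw [mul_assoc, ← Complex.exp_add]
    congr 2
    ring
  · refine (hd (-s.re)).congr fun n => ?_
    have : (0 : ℝ) ≤ 2 * Real.pi * n / N := by positivity
    rw [Real.rpow_neg this, norm_mul, norm_real, Real.norm_of_nonneg (Real.exp_pos _).le]
    rfl

/-! ### Comparison of the Riesz mean with the full series. -/

theorem abs_riesz_weight_sub_one_le {ν X ρ ε : ℝ} (hν : 0 < ν) (hX : 0 < X) (hρ : 1 ≤ ρ)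
    (hε0 : 0 ≤ ε) (hε : ε ≤ 1) :
    |(if ν < X then (1 - ν / X) ^ ρ else 0) - 1| ≤ (1 + ρ * ν) * X ^ (-ε) := by
  set w : ℝ := if ν < X then (1 - ν / X) ^ ρ else 0 with hw
  have hw0 : 0 ≤ w ∧ w ≤ 1 ∧ 1 - w ≤ ρ * (ν / X) := by
    have hx : 0 < ν / X := by positivity
    rw [hw]
    split_ifs with h
    · have hx1 : ν / X < 1 := (div_lt_one hX).2 h
      refine ⟨Real.rpow_nonneg (by linarith) _,
        Real.rpow_le_one (by linarith) (by linarith) (by linarith), ?_⟩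
      have := one_add_mul_self_le_rpow_one_add (by linarith : -1 ≤ -(ν / X)) hρ
      rw [← sub_eq_add_neg] at this
      linarith
    · have hx1 : 1 ≤ ν / X := (one_le_div hX).2 (not_lt.1 h)
      exact ⟨le_rfl, zero_le_one, by nlinarith⟩
  rw [abs_sub_comm, abs_of_nonneg (by linarith)]
  have hXε := Real.rpow_pos_of_pos hX (-ε)
  have hρν : 0 < ρ * ν := by positivity
  -- For `X ≤ 1` the trivial bound `1 ≤ X^{-ε}` suffices; for `X ≥ 1` Bernoulli's `1 - w ≤ ρν/X` is
  -- used with `X⁻¹ ≤ X^{-ε}`.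
  rcases le_total X 1 with h | h
  · have := Real.one_le_rpow_of_pos_of_le_one_of_nonpos hX h (neg_nonpos.2 hε0)
    nlinarith
  · have h3 : X⁻¹ ≤ X ^ (-ε) := by
      rw [← Real.rpow_neg_one]
      exact Real.rpow_le_rpow_of_exponent_le h (by linarith)
    calc 1 - w ≤ ρ * (ν / X) := hw0.2.2
      _ = (ρ * ν) * X⁻¹ := by ring
      _ ≤ (ρ * ν) * X ^ (-ε) := by gcongr
      _ ≤ _ := by nlinarith

theorem norm_rieszMean_sub_dampedSeries_le {N : ℕ} [NeZero N] (k : ℤ) {d : ℕ → ℂ} (d0 : d 0 = 0)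
    (hd : ∀ r : ℝ, Summable fun n : ℕ =>
      ‖d n‖ * Real.exp (-(2 * Real.pi * n / N)) * (2 * Real.pi * n / N) ^ r)
    {ρ ε : ℝ} (hρ : 1 ≤ ρ) (hε0 : 0 ≤ ε) (hε : ε ≤ 1) :
    ∃ C : ℝ, ∀ X : ℝ, 0 < X →
      ‖rieszMean N k d ρ X - dampedSeries N d (((k : ℂ) - 1) / 2)‖ ≤ C * X ^ (-ε) := by
  have hN : (0 : ℝ) < N := Nat.cast_pos.mpr (NeZero.pos N)
  set α : ℝ := ((k : ℝ) - 1) / 2 with hα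
  set b : ℕ → ℂ := fun n => d n *
    ((Real.exp (-(2 * Real.pi * n / N)) / (2 * Real.pi * n / N) ^ α : ℝ) : ℂ) with hb
  have hnb : ∀ n, ‖b n‖ = ‖d n‖ * Real.exp (-(2 * Real.pi * n / N)) * (2 * Real.pi * n / N) ^ (-α) := by
    intro n
    have h0 : (0 : ℝ) ≤ 2 * Real.pi * n / N := by positivity
    rw [hb, norm_mul, norm_real, Real.norm_of_nonneg (by positivity), Real.rpow_neg h0]
    ring
  have hbs : Summable b := ((hd (-α)).congr fun n => (hnb n).symm).of_norm
  have hser : dampedSeries N d (((k : ℂ) - 1) / 2) = ∑' n, b n := by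
    refine tsum_congr fun n => ?_
    have h0 : (0 : ℝ) ≤ 2 * Real.pi * n / N := by positivity
    have : -(((k : ℂ) - 1) / 2) = ((-α : ℝ) : ℂ) := by rw [hα]; push_cast; ring
    rw [this, ← ofReal_cpow h0, hb, Real.rpow_neg h0]
    push_cast
    ring
  set u : ℕ → ℝ := fun n => ‖b n‖ * (1 + ρ * (2 * Real.pi * n / N)) with hu
  have hus : Summable u := by
    refine ((hd (-α)).add ((hd (1 - α)).mul_left ρ)).congr fun n => ?_
    rcases eq_or_ne n 0 with rfl | hn
    · simp [hu, hb, d0]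
    · simp only [hu, hnb]
      rw [show 1 - α = 1 + -α by ring, Real.rpow_add (frequency_pos N hn), Real.rpow_one]
      ring
  refine ⟨∑' n, u n, fun X hX => ?_⟩
  -- Extending the weight by zero makes the finite mean a series, comparable term by term with `∑ b
  -- n`.
  set w : ℕ → ℝ := fun n => if 2 * Real.pi * n / N < X then (1 - 2 * Real.pi * n / N / X) ^ ρ else 0
    with hw
  have hmean : HasSum (fun n => b n * w n) (rieszMean N k d ρ X) := by
    have hmem : ∀ n : ℕ, n ∈ Finset.Ico 1 ⌈(N : ℝ) * X / (2 * Real.pi)⌉₊ ↔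
        n ≠ 0 ∧ 2 * Real.pi * n / N < X := by
      intro n
      rw [Finset.mem_Ico, Nat.lt_ceil, Nat.one_le_iff_ne_zero, lt_div_iff₀ (by positivity),
        div_lt_iff₀ hN, mul_comm (n : ℝ), mul_comm X]
    have hsum : rieszMean N k d ρ X
        = ∑ n ∈ Finset.Ico 1 ⌈(N : ℝ) * X / (2 * Real.pi)⌉₊, b n * w n := by
      refine Finset.sum_congr rfl fun n hn => ?_
      simp only [hb, hw, if_pos ((hmem n).1 hn).2]
      push_cast
      ring
    rw [hsum]
    refine hasSum_sum_of_ne_finset_zero fun n hn => ?_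
    rw [hmem, not_and_or, not_not] at hn
    rcases hn with rfl | hn
    · simp [hb, d0]
    · simp [hw, if_neg hn]
  have hdiff := hmean.sub hbs.hasSum
  rw [hser, ← tsum_mul_right]
  refine hdiff.tsum_eq ▸ tsum_of_norm_bounded (hus.mul_right _).hasSum fun n => ?_
  rcases eq_or_ne n 0 with rfl | hn
  · simp [hb, hu, d0]
  · have h := abs_riesz_weight_sub_one_le (frequency_pos N hn) hX hρ hε0 hε
    have : b n * w n - b n = b n * ((w n - 1 : ℝ) : ℂ) := by push_cast; ring
    rw [this, norm_mul, norm_real, Real.norm_eq_abs, hu, mul_assoc]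
    gcongr

/-! ### The identity for `L_f(ψ_s)` and the conclusion. -/

theorem summable_fourierCoefficient_mul_exp {Γ : Subgroup (GL (Fin 2) ℝ)} {k : ℤ} (g : CuspForm Γ k)
    (h1 : (1 : ℝ) ∈ Γ.strictPeriods) (N : ℕ) [NeZero N] :
    Summable fun n : ℕ => ‖fourierCoefficient g n‖ * Real.exp (-(2 * Real.pi * n / N) / 2) := by
  have hN : (0 : ℝ) < N := Nat.cast_pos.mpr (NeZero.pos N)
  -- At the point `i/(2N)` the `n`-th exponential is `e^{-ν_n/2}`.
  refine (hasSum_fourierCoefficient g h1 (t := 1 / (2 * N)) (by positivity)).summable.norm.congr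
    fun n => ?_
  rw [norm_mul, Complex.norm_exp, ← ofReal_neg, ← ofReal_mul, ofReal_re]
  congr 2
  field_simp

/-- `L_f(ψ_s)` as a damped Dirichlet series of the Fricke transform. -/
theorem LValue_psi_eq_dampedSeries {N : ℕ} [NeZero N] {k : ℤ}
    (f : CuspForm (CongruenceSubgroup.Gamma1 N : Subgroup (GL (Fin 2) ℝ)) k) {s : ℂ} (hs : 0 < s.re)
    (hconv : ConvergesAbsolutely (fourierCoefficient f) (psi k s)) :
    LValue (fourierCoefficient f) (psi k s) = I ^ k * (((N : ℝ) ^ ((k : ℝ) / 2) : ℝ) : ℂ)⁻¹ *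
      dampedSeries N (fourierCoefficient (fricke N k f)) s := by
  have hN : (0 : ℝ) < N := Nat.cast_pos.mpr (NeZero.pos N)
  obtain ⟨g, hg⟩ := exists_cuspForm_eq_fricke f
  have hΓ := one_mem_strictPeriods_conj_frickeMatrix N
  let F : ℝ → ℂ := fun t => if ht : 0 < t then f ⟨I * t, by simpa using ht⟩ else 0
  let G : ℝ → ℂ := fun v => if hv : 0 < (1 + v) / N then
    g ⟨I * ((1 + v) / N : ℝ), by simpa using hv⟩ else 0
  have hF : ∀ t : ℝ, 0 < t → HasSum (fun n : ℕ =>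
      fourierCoefficient f n * cexp (-((2 * Real.pi * n : ℝ) : ℂ) * t)) (F t) := by
    intro t ht
    simp only [F, dif_pos ht]
    exact hasSum_fourierCoefficient f (by simp) ht
  have hG : ∀ v : ℝ, 0 < v → HasSum (fun n : ℕ => fourierCoefficient g n *
      cexp (-((2 * Real.pi * n : ℝ) : ℂ) * (((1 + v) / N : ℝ) : ℂ))) (G v) := by
    intro v hv
    have hv' : 0 < (1 + v) / N := by positivity
    simp only [G, dif_pos hv']
    exact hasSum_fourierCoefficient g hΓ hv'
  have hFG : ∀ v : ℝ, 0 < v → F (1 + v)⁻¹ =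
      I ^ k * (((N : ℝ) ^ ((k : ℝ) / 2) : ℝ) : ℂ)⁻¹ * ((1 + v : ℝ) : ℂ) ^ k * G v := by
    intro v hv
    have hv' : 0 < (1 + v) / N := by positivity
    have hv1 : 0 < (1 + v)⁻¹ := by positivity
    simp only [F, G, dif_pos hv', dif_pos hv1]
    have hpow : (((1 + v)⁻¹ : ℝ) : ℂ) ^ (-k) = ((1 + v : ℝ) : ℂ) ^ k := by
      rw [ofReal_inv, inv_zpow', neg_neg]
    rw [fricke_apply_imaginary_axis N k f hv1, hg, hpow]
    congr 5
    field_simp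
  have hd := summable_damped_mul_rpow (summable_fourierCoefficient_mul_exp g hΓ N)
  rw [LValue_eq_integral hconv hF, integral_psi_mul hFG,
    mellin_eq_dampedSeries (fourierCoefficient_zero g hΓ) hd hG hs, hg]
  have := Gamma_ne_zero_of_re_pos hs
  field_simp

end RieszMean

theorem mainTheorem3 (N : ℕ) [NeZero N] (k : ℤ) (hk : 0 < k) (hk2 : Even k)
    (χ : DirichletCharacter ℂ N)
    (f : CuspForm ((CongruenceSubgroup.Gamma1 N) : Subgroup (GL (Fin 2) ℝ)) k) (hf : RieszMean.HasNebentypus χ f) :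
    ∃ Λ : ℂ → ℂ, RieszMean.IsContinuationOfLPsi k f Λ ∧
      ∀ ρ : ℝ, 1 < ρ → ∀ ε : ℝ, 0 < ε → ε < 1 →
        ∃ C : ℝ, ∀ X : ℝ, 0 < X →
          ‖RieszMean.rieszMean N k
                (RieszMean.fourierCoefficient (RieszMean.fricke N k f)) ρ X
              - Complex.I ^ (-k) * (((N : ℝ) ^ ((k : ℝ) / 2) : ℝ) : ℂ)
                * Λ (((k : ℂ) - 1) / 2)‖
            ≤ C * X ^ (-ε) := by
  have hN : (0 : ℝ) < N := Nat.cast_pos.mpr (NeZero.pos N)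
  obtain ⟨g, hg⟩ := RieszMean.exists_cuspForm_eq_fricke f
  have hΓ := RieszMean.one_mem_strictPeriods_conj_frickeMatrix N
  have d0 := RieszMean.fourierCoefficient_zero g hΓ
  have hd := RieszMean.summable_damped_mul_rpow
    (RieszMean.summable_fourierCoefficient_mul_exp g hΓ N)
  rw [hg] at d0 hd
  obtain ⟨C₀, hC₀, hsq⟩ := RieszMean.exists_tsum_sq_coeff_le f (by simp)
  obtain ⟨D, -, hD⟩ := RieszMean.exists_tsum_coeff_le hC₀ hsq
  set A : ℂ := Complex.I ^ k * (((N : ℝ) ^ ((k : ℝ) / 2) : ℝ) : ℂ)⁻¹ with hA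
  -- The point `(k-1)/2` lies on the edge of the strip, so `Λ` is defined by the entire series
  -- rather than by `L_f(ψ_s)`.
  refine ⟨fun s => A * RieszMean.dampedSeries N
    (RieszMean.fourierCoefficient (RieszMean.fricke N k f)) s, ⟨?_, fun s hs hs1 => ?_⟩,
    fun ρ hρ ε hε0 hε1 => ?_⟩
  · exact (RieszMean.differentiable_dampedSeries d0 hd).const_mul A
  · have hconv := RieszMean.convergesAbsolutely_psi hD hs hs1
    exact ⟨hconv, (RieszMean.LValue_psi_eq_dampedSeries f hs hconv).symm⟩
  · obtain ⟨C, hC⟩ :=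
      RieszMean.norm_rieszMean_sub_dampedSeries_le k d0 hd hρ.le hε0.le hε1.le
    refine ⟨C, fun X hX => ?_⟩
    have hI := zpow_ne_zero k Complex.I_ne_zero
    have hP : (((N : ℝ) ^ ((k : ℝ) / 2) : ℝ) : ℂ) ≠ 0 := by
      exact_mod_cast (Real.rpow_pos_of_pos hN _).ne'
    have h1 : Complex.I ^ (-k) * (((N : ℝ) ^ ((k : ℝ) / 2) : ℝ) : ℂ) * A = 1 := by
      rw [hA, zpow_neg]
      field_simp
    rw [← mul_assoc, h1, one_mul]
    exact hC X hX
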